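/- Let $u>0$, $\lambda>0$, $\rho\ge 0$, and let $\nu$ be a probability law on $\mathbb{R}$ with finite mean $\mu>0$. Let $N$ be a Poisson process with intensity $\lambda$ and let $X_1,X_2,\dots$ be iid with law $\nu$, independent of $N$. The classical (Cramér–Lundberg) risk process is $$R(t)=u+\mu\lambda(1+\rho)\,t-\sum_{i=1}^{N(t)}X_i,\qquad t\ge 0 .$$ For $\alpha\in(0,1)$ let $L_\alpha$ be an $\alpha$-stable subordinator, i.e. a nondecreasing càdlàg Lévy process with $L_\alpha(0)=0$ and $\mathbb{E}\,e^{-sL_\alpha(t)}=e^{-ts^\alpha}$ for $s,t\ge0$. Let $Y_\alpha(t)=\inf\{w\ge 0: L_\alpha(w)>t\}$ be its inverse, and assume that $N$ and $Y_\alpha$ are independent and that $(X_i)_{i\ge1}$ is independent of $(N,Y_\alpha)$. The fractional Poisson process is $N_\alpha(t)=N(Y_\alpha(t))$, and the fractional risk process is $$R_\alpha(t)=u+\mu\lambda(1+\rho)\,Y_\alpha(t)-\sum_{i=1}^{N_\alpha(t)}X_i,\qquad t\ge 0 .$$ Then there is a function $\psi:\mathbb{R}\to\mathbb{R}$, depending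 only on $(u,\lambda,\rho,\nu)$, such that for every $v\in\mathbb{R}$ $$\lim_{t\to\infty}P\Big(\inf_{0\le s\le t}R(s)\le v\Big)=\psi(v)$$ for every classical model as above, and $$\lim_{t\to\infty}P\Big(\inf_{0\le s\le t}R_\alpha(s)\le v\Big)=\psi(v)$$ for every $\alpha\in(0,1)$ and every fractional model as above. In particular, the infinite-horizon ruin probability of the fractional risk process exists, does not depend on $\alpha$, and coincides with the classical Cramér–Lundberg ruin probability. The models may live on different probability spaces. -/

import Mathlib

open MeasureTheory ProbabilityTheory Filter Topology
open scoped NNReal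

namespace FractionalRisk

/-- A path on `[0, ∞)` is càdlàg: right-continuous with left limits. -/
def IsCadlag {E : Type*} [TopologicalSpace E] (f : ℝ≥0 → E) : Prop :=
  (∀ t, ContinuousWithinAt f (Set.Ici t) t) ∧ ∀ t, ∃ l, Tendsto f (𝓝[<] t) (𝓝 l)

/-- `N` is a homogeneous Poisson process with intensity `lam`: it starts at `0`, its increments are
independent and Poisson distributed, and its paths are a.s. nondecreasing and càdlàg. -/
structure IsPoissonProcess {Ω : Type*} [MeasurableSpace Ω] (P : Measure Ω) (lam : ℝ≥0)
    (N : ℝ≥0 → Ω → ℕ) : Prop where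
  measurable : ∀ t, Measurable (N t)
  zero : ∀ᵐ ω ∂P, N 0 ω = 0
  indep : HasIndepIncrements N P
  law : ∀ s t : ℝ≥0, s ≤ t →
    P.map (fun ω => N t ω - N s ω) = poissonMeasure (lam * (t - s))
  paths : ∀ᵐ ω ∂P, Monotone (fun t => N t ω) ∧ IsCadlag (fun t => N t ω)

/-- `L` is a Lévy subordinator: a nondecreasing càdlàg process started at `0` that is continuous in
probability and has independent and stationary increments. -/
structure IsSubordinator {Ω : Type*} [MeasurableSpace Ω] (P : Measure Ω)
    (L : ℝ≥0 → Ω → ℝ) : Prop where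
  measurable : ∀ t, Measurable (L t)
  zero : ∀ᵐ ω ∂P, L 0 ω = 0
  indep : HasIndepIncrements L P
  stationary : ∀ s t : ℝ≥0, s ≤ t →
    IdentDistrib (fun ω => L t ω - L s ω) (L (t - s)) P P
  continuous_in_prob : ∀ t, TendstoInMeasure P L (𝓝 t) (L t)
  paths : ∀ᵐ ω ∂P, Monotone (fun t => L t ω) ∧ IsCadlag (fun t => L t ω)

/-- `L` is an `α`-stable subordinator: a subordinator with Laplace exponent `s ↦ s ^ α`. -/
structure IsStableSubordinator {Ω : Type*} [MeasurableSpace Ω] (P : Measure Ω) (α : ℝ)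
    (L : ℝ≥0 → Ω → ℝ) : Prop extends IsSubordinator P L where
  laplace : ∀ (t : ℝ≥0) (s : ℝ), 0 ≤ s →
    ∫ ω, Real.exp (-s * L t ω) ∂P = Real.exp (-(t : ℝ) * s ^ α)

/-- The inverse (first-passage time) process `Y(t) = inf {w ≥ 0 : L(w) > t}`. -/
noncomputable def inverseProcess {Ω : Type*} (L : ℝ≥0 → Ω → ℝ) (t : ℝ≥0) (ω : Ω) : ℝ≥0 :=
  sInf {w : ℝ≥0 | (t : ℝ) < L w ω}

/-- The time-changed counting process `N(Y(t))`. -/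
def timeChange {Ω : Type*} (N : ℝ≥0 → Ω → ℕ) (Y : ℝ≥0 → Ω → ℝ≥0) (t : ℝ≥0) (ω : Ω) : ℕ :=
  N (Y t ω) ω

/-- The claim sizes `X 0, X 1, …` are iid with law `ν`. -/
structure IsClaimSequence {Ω : Type*} [MeasurableSpace Ω] (P : Measure Ω) (ν : Measure ℝ)
    (X : ℕ → Ω → ℝ) : Prop where
  measurable : ∀ i, Measurable (X i)
  indep : iIndepFun X P
  law : ∀ i, P.map (X i) = ν

/-- The data of a classical Cramér–Lundberg model: a Poisson process `N` of claim arrivals and iid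
claim sizes `X`, independent of `N`. -/
structure IsClassicalModel {Ω : Type*} [MeasurableSpace Ω] (P : Measure Ω) (lam : ℝ≥0)
    (ν : Measure ℝ) (N : ℝ≥0 → Ω → ℕ) (X : ℕ → Ω → ℝ) : Prop where
  poisson : IsPoissonProcess P lam N
  claims : IsClaimSequence P ν X
  indep_claims : IndepFun (fun ω i => X i ω) (fun ω t => N t ω) P

/-- The data of a fractional model of index `α`: a Poisson process `N`, an `α`-stable subordinator
`L` whose inverse `Y` is independent of `N`, and iid claim sizes `X`, independent of `(N, Y)`.
The fractional Poisson process of the model is `N(Y(t))`. -/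
structure IsFractionalModel {Ω : Type*} [MeasurableSpace Ω] (P : Measure Ω) (α : ℝ) (lam : ℝ≥0)
    (ν : Measure ℝ) (N : ℝ≥0 → Ω → ℕ) (L : ℝ≥0 → Ω → ℝ) (X : ℕ → Ω → ℝ) : Prop where
  poisson : IsPoissonProcess P lam N
  stable : IsStableSubordinator P α L
  claims : IsClaimSequence P ν X
  indep_clock : IndepFun (fun ω t => N t ω) (fun ω t => inverseProcess L t ω) P
  indep_claims : IndepFun (fun ω i => X i ω)
    (fun ω => ((fun t => N t ω, fun t => inverseProcess L t ω) :
      (ℝ≥0 → ℕ) × (ℝ≥0 → ℝ≥0))) P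

/-- The classical risk process `u + μ λ (1 + ρ) t - ∑_{i=1}^{N(t)} X_i`. -/
noncomputable def classicalRisk {Ω : Type*} (u mu rho : ℝ) (lam : ℝ≥0)
    (N : ℝ≥0 → Ω → ℕ) (X : ℕ → Ω → ℝ) (t : ℝ≥0) (ω : Ω) : ℝ :=
  u + mu * lam * (1 + rho) * t - ∑ i ∈ Finset.range (N t ω), X i ω

/-- The fractional risk process `u + μ λ (1 + ρ) Y(t) - ∑_{i=1}^{N(Y(t))} X_i`, with `Y` the
inverse of `L`. -/
noncomputable def fractionalRisk {Ω : Type*} (u mu rho : ℝ) (lam : ℝ≥0)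
    (N : ℝ≥0 → Ω → ℕ) (L : ℝ≥0 → Ω → ℝ) (X : ℕ → Ω → ℝ) (t : ℝ≥0) (ω : Ω) : ℝ :=
  u + mu * lam * (1 + rho) * inverseProcess L t ω
    - ∑ i ∈ Finset.range (timeChange N (inverseProcess L) t ω), X i ω

/-- The running infimum `inf_{0 ≤ s ≤ t} R(s)`. (Almost every path of the risk processes is bounded
on `[0, t]`, so that this is the genuine infimum.) -/
noncomputable def runningInf {Ω : Type*} (R : ℝ≥0 → Ω → ℝ) (t : ℝ≥0) (ω : Ω) : ℝ :=
  sInf ((fun s => R s ω) '' Set.Icc 0 t)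

/-- The finite-horizon ruin probability `ψ(v, t) = P(inf_{0 ≤ s ≤ t} R(s) ≤ v)`. -/
noncomputable def ruinProb {Ω : Type*} [MeasurableSpace Ω] (P : Measure Ω)
    (R : ℝ≥0 → Ω → ℝ) (v : ℝ) (t : ℝ≥0) : ℝ :=
  P.real {ω | runningInf R t ω ≤ v}

end FractionalRisk

/-! The fractional process is the classical path `R` run along the clock `Y`. A stable subordinator
is a.s. strictly increasing from `0` and unbounded, so `Y` maps `[0, t]` onto `[0, Y(t)]` and skips
no level: both processes reach `v` in infinite time on the same event, up to a null set. The infimum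
of `R` over a compact interval is attained (`sInf_image_le_iff`), so finite-horizon ruin means that
`v` is reached, and continuity from below gives the limit `P(∃ s, R(s) ≤ v)`. This number depends
only on the parameters: the event is determined by countably many coordinates, and the
finite-dimensional laws fix the law of `(X, N)`. -/

namespace FractionalRisk

/-! ### Deterministic facts about counting paths and first-passage times. -/

section Paths

variable {f : ℝ≥0 → ℕ} {S : ℕ → ℝ} {u c v : ℝ}

lemma exists_isLeast_hitting (hc : ∀ t, ContinuousWithinAt f (Set.Ici t) t)
    {k : ℕ} (h : ∃ s, k ≤ f s) : ∃ τ, IsLeast {s | k ≤ f s} τ := by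
  refine ⟨sInf {s | k ≤ f s}, ?_, fun s hs => csInf_le (OrderBot.bddBelow _) hs⟩
  set τ := sInf {s | k ≤ f s} with hτ
  -- Since `ℕ` is discrete, right-continuity makes `f` constant just after `τ`.
  have hev : {s | f s = f τ} ∈ 𝓝[≥] τ := (hc τ) (by simp : {f τ} ∈ 𝓝 (f τ))
  obtain ⟨b, hb, hsub⟩ := (mem_nhdsGE_iff_exists_Ico_subset' (lt_add_one τ)).1 hev
  obtain ⟨s, hs, hsb⟩ := exists_lt_of_csInf_lt h (hτ ▸ hb : sInf {s | k ≤ f s} < b)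
  have hsτ : f s = f τ := hsub ⟨csInf_le (OrderBot.bddBelow _) hs, hsb⟩
  exact (show k ≤ f s from hs).trans_eq hsτ

/-- On a bounded time interval the path `s ↦ u + c s - S (f s)` attains its infimum. -/
lemma sInf_image_le_iff (hf : Monotone f) (hc : ∀ t, ContinuousWithinAt f (Set.Ici t) t)
    (hcnn : 0 ≤ c) (t : ℝ≥0) :
    sInf ((fun s : ℝ≥0 => u + c * s - S (f s)) '' Set.Icc 0 t) ≤ v ↔
      ∃ s ≤ t, u + c * s - S (f s) ≤ v := by
  have hτ : ∀ k, ∃ τ, (∃ s, k ≤ f s) → IsLeast {s | k ≤ f s} τ := fun k => by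
    by_cases h : ∃ s, k ≤ f s
    · obtain ⟨τ, hτ⟩ := exists_isLeast_hitting hc h
      exact ⟨τ, fun _ => hτ⟩
    · exact ⟨0, fun h' => absurd h' h⟩
  choose τ hτ using hτ
  have hτ' : ∀ s, IsLeast {r | f s ≤ f r} (τ (f s)) := fun s => hτ _ ⟨s, le_rfl⟩
  have hle : ∀ s, τ (f s) ≤ s := fun s => (hτ' s).2 (le_refl (f s))
  have heq : ∀ s, f (τ (f s)) = f s := fun s => le_antisymm (hf (hle s)) (hτ' s).1
  have hfin : (f '' Set.Icc 0 t).Finite :=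
    (Set.finite_Iic (f t)).subset (by rintro _ ⟨s, hs, rfl⟩; exact hf hs.2)
  -- On each level set of `f` the drift makes the path smallest at the first hitting time, so only
  -- finitely many candidates remain.
  obtain ⟨k, ⟨r, hr, rfl⟩, hmin⟩ := Set.exists_min_image _ (fun k => u + c * τ k - S k) hfin
    ⟨f 0, 0, by simp, rfl⟩
  have hleast : IsLeast ((fun s : ℝ≥0 => u + c * s - S (f s)) '' Set.Icc 0 t)
      (u + c * τ (f r) - S (f r)) := by
    refine ⟨⟨τ (f r), ⟨zero_le, (hle r).trans hr.2⟩, by simp [heq]⟩, ?_⟩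
    rintro _ ⟨s, hs, rfl⟩
    refine (hmin (f s) ⟨s, hs, rfl⟩).trans ?_
    have : (τ (f s) : ℝ) ≤ s := by exact_mod_cast hle s
    have := mul_le_mul_of_nonneg_left this hcnn
    simp only
    linarith
  rw [hleast.csInf_eq]
  constructor
  · intro h
    exact ⟨τ (f r), (hle r).trans hr.2, by rwa [heq]⟩
  · rintro ⟨s, hs, h⟩
    exact (hleast.2 ⟨s, ⟨zero_le, hs⟩, rfl⟩).trans h

/-- Whether the path `s ↦ u + c s - S (f s)` ever reaches `v` can be read off from countably many
values of `f`. -/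
lemma exists_le_iff_denseSeq (hf : Monotone f) (hc : ∀ t, ContinuousWithinAt f (Set.Ici t) t)
    (hcnn : 0 ≤ c) :
    (∃ s : ℝ≥0, u + c * s - S (f s) ≤ v) ↔
      ∃ k, ∀ m : ℕ, ∃ n, f (TopologicalSpace.denseSeq ℝ≥0 n) = k ∧
        u + c * (TopologicalSpace.denseSeq ℝ≥0 n : ℝ≥0) - S k ≤ v + 1 / (m + 1) := by
  constructor
  · rintro ⟨s, hs⟩
    refine ⟨f s, fun m => ?_⟩
    have h1 : ∀ᶠ r in 𝓝[>] s, f r = f s :=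
      nhdsWithin_mono _ Set.Ioi_subset_Ici_self ((hc s) (by simp : {f s} ∈ 𝓝 (f s)))
    have h2 : ∀ᶠ r : ℝ≥0 in 𝓝[>] s, u + c * r - S (f s) < v + 1 / (m + 1) := by
      have hcont : Continuous fun r : ℝ≥0 => u + c * (r : ℝ) - S (f s) := by fun_prop
      refine nhdsWithin_le_nhds (hcont.tendsto s |>.eventually_lt_const ?_)
      have : (0 : ℝ) < 1 / (m + 1) := by positivity
      linarith
    obtain ⟨b, hb, hsub⟩ :=
      (mem_nhdsGT_iff_exists_Ioo_subset' (lt_add_one s)).1 (h1.and h2)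
    obtain ⟨_, ⟨n, rfl⟩, hn⟩ := (TopologicalSpace.denseRange_denseSeq ℝ≥0).exists_between hb
    exact ⟨n, (hsub hn).1, (hsub hn).2.le⟩
  · rintro ⟨k, hk⟩
    obtain ⟨n₀, hn₀, -⟩ := hk 0
    obtain ⟨τ, hτ⟩ := exists_isLeast_hitting hc ⟨_, hn₀.ge⟩
    have hτk : f τ = k := le_antisymm (hn₀ ▸ hf (hτ.2 hn₀.ge)) hτ.1
    -- All sampled times at level `k` lie at or after `τ`, so the value at `τ` is at most `v + 1 /
    -- (m + 1)` for every `m`.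
    refine ⟨τ, le_of_forall_pos_le_add fun ε hε => ?_⟩
    obtain ⟨m, hm⟩ := exists_nat_one_div_lt hε
    obtain ⟨n, hn, hle⟩ := hk m
    have : (τ : ℝ) ≤ (TopologicalSpace.denseSeq ℝ≥0 n : ℝ≥0) := by exact_mod_cast hτ.2 hn.ge
    have := mul_le_mul_of_nonneg_left this hcnn
    rw [hτk]
    linarith

lemma firstPassage_apply {L : ℝ≥0 → ℝ} (hL : StrictMono L) (w : ℝ≥0) :
    sInf {r : ℝ≥0 | L w < L r} = w := by
  have : {r : ℝ≥0 | L w < L r} = Set.Ioi w := Set.ext fun _ => hL.lt_iff_lt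
  rw [this, csInf_Ioi]

/-- The first-passage times of a strictly increasing unbounded path sweep out whole intervals. -/
lemma image_firstPassage {L : ℝ≥0 → ℝ} (h0 : L 0 = 0) (hL : StrictMono L)
    (hunb : ∀ K, ∃ w, K < L w) (t : ℝ≥0) :
    (fun s : ℝ≥0 => sInf {w : ℝ≥0 | (s : ℝ) < L w}) '' Set.Icc 0 t =
      Set.Icc 0 (sInf {w : ℝ≥0 | (t : ℝ) < L w}) := by
  have hnn : ∀ w, 0 ≤ L w := fun w => h0 ▸ hL.monotone (zero_le : 0 ≤ w)
  ext w
  constructor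
  · rintro ⟨s, hs, rfl⟩
    refine ⟨zero_le, csInf_le_csInf (OrderBot.bddBelow _) (hunb t) fun w hw => ?_⟩
    have hst : (s : ℝ) ≤ t := by exact_mod_cast hs.2
    exact hst.trans_lt (show (t : ℝ) < L w from hw)
  · rintro ⟨-, hw⟩
    rcases hw.eq_or_lt with rfl | hlt
    · exact ⟨t, by simp, rfl⟩
    · have hLt : L w ≤ t := by
        by_contra! h
        exact absurd (csInf_le (OrderBot.bddBelow {w : ℝ≥0 | (t : ℝ) < L w}) h) (not_le.2 hlt)
      exact ⟨⟨L w, hnn w⟩, ⟨zero_le, hLt⟩, firstPassage_apply hL w⟩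

lemma exists_firstPassage_eq {L : ℝ≥0 → ℝ} (h0 : L 0 = 0) (hL : StrictMono L) (w : ℝ≥0) :
    ∃ t : ℝ≥0, sInf {r : ℝ≥0 | (t : ℝ) < L r} = w :=
  ⟨⟨L w, h0 ▸ hL.monotone (zero_le : 0 ≤ w)⟩, firstPassage_apply hL w⟩

end Paths

/-! ### Uniqueness of the law of a Poisson process. -/

section PoissonLaw

/-- The points `0 = t₀ < t₁ < ⋯` of `I ∪ {0}` in increasing order. -/
noncomputable def orderedTimes (I : Finset ℝ≥0) :
    Fin ((insert 0 I).card - 1 + 1) ↪o ℝ≥0 :=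
  (insert 0 I).orderEmbOfFin (Nat.sub_add_cancel (Finset.card_pos.2 ⟨0, by simp⟩)).symm

lemma exists_orderedTimes_eq {I : Finset ℝ≥0} {t : ℝ≥0} (ht : t ∈ insert 0 I) :
    ∃ k, orderedTimes I k = t := by
  have : t ∈ Set.range (orderedTimes I) := by
    rw [orderedTimes, Finset.range_orderEmbOfFin]
    exact_mod_cast ht
  exact this

lemma orderedTimes_zero (I : Finset ℝ≥0) : orderedTimes I 0 = 0 := by
  obtain ⟨k, hk⟩ := exists_orderedTimes_eq (I := I) (t := 0) (by simp)
  exact le_antisymm (((orderedTimes I).monotone (Fin.zero_le k)).trans_eq hk) zero_le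

/-- The position of a time among the ordered times. -/
noncomputable def timeIndex (I : Finset ℝ≥0) (i : I) : Fin ((insert 0 I).card - 1 + 1) :=
  (exists_orderedTimes_eq (I := I) (Finset.mem_insert_of_mem i.2)).choose

lemma orderedTimes_timeIndex (I : Finset ℝ≥0) (i : I) : orderedTimes I (timeIndex I i) = i :=
  (exists_orderedTimes_eq (I := I) (Finset.mem_insert_of_mem i.2)).choose_spec

/-- The law at the times of `I` of a Poisson process with intensity `lam`. -/
noncomputable def poissonMarginal (lam : ℝ≥0) (I : Finset ℝ≥0) : Measure (I → ℕ) :=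
  (Measure.pi fun j : Fin ((insert 0 I).card - 1) =>
    poissonMeasure (lam * (orderedTimes I j.succ - orderedTimes I j.castSucc))).map
    fun d i => ∑ j with j.castSucc < timeIndex I i, d j

/-- The sum telescopes; monotonicity makes the truncated subtraction exact. -/
lemma sum_increments_eq {n : ℕ} {a : Fin (n + 1) → ℕ} (ha : Monotone a) (h0 : a 0 = 0)
    (k : Fin (n + 1)) : ∑ j : Fin n with j.castSucc < k, (a j.succ - a j.castSucc) = a k := by
  induction k using Fin.induction with
  | zero => simp [h0]
  | succ i ih =>
    have : ({j | j.castSucc < i.succ} : Finset (Fin n)) =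
        insert i ({j | j.castSucc < i.castSucc} : Finset (Fin n)) := by
      ext j
      simp only [Finset.mem_filter, Finset.mem_univ, true_and, Finset.mem_insert, Fin.lt_def,
        Fin.val_castSucc, Fin.val_succ, Fin.ext_iff]
      omega
    rw [this, Finset.sum_insert (by simp), ih]
    exact Nat.sub_add_cancel (ha (Fin.castSucc_lt_succ).le)

variable {Ω : Type*} [MeasurableSpace Ω] {P : Measure Ω} {lam : ℝ≥0} {N : ℝ≥0 → Ω → ℕ}

instance (lam : ℝ≥0) (I : Finset ℝ≥0) : IsProbabilityMeasure (poissonMarginal lam I) :=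
  Measure.isProbabilityMeasure_map (by fun_prop)

/-- The finite-dimensional laws of a Poisson process are determined by its intensity. -/
lemma IsPoissonProcess.isProjectiveLimit [IsProbabilityMeasure P] (hN : IsPoissonProcess P lam N) :
    IsProjectiveLimit (P.map fun ω t => N t ω) (poissonMarginal lam) := by
  intro I
  have hmeas := hN.measurable
  set t := orderedTimes I
  have hpi : P.map (fun ω j => N (t (Fin.succ j)) ω - N (t (Fin.castSucc j)) ω) =
      Measure.pi fun j : Fin ((insert 0 I).card - 1) =>
        poissonMeasure (lam * (t j.succ - t j.castSucc)) := by
    have hind := hN.indep _ t t.monotone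
    rw [(iIndepFun_iff_map_fun_eq_pi_map (fun j => by fun_prop)).1 hind]
    congr 1
    funext j
    exact hN.law _ _ (t.monotone (Fin.castSucc_lt_succ).le)
  rw [Measure.map_map (by fun_prop) (by fun_prop), poissonMarginal, ← hpi,
    Measure.map_map (by fun_prop) (by fun_prop)]
  refine Measure.map_congr ?_
  filter_upwards [hN.zero, hN.paths] with ω h0 hω
  funext i
  simp only [Function.comp_apply, Finset.restrict]
  rw [sum_increments_eq (a := fun j => N (t j) ω) (hω.1.comp t.monotone)
    (by simp [t, orderedTimes_zero, h0]), orderedTimes_timeIndex]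

end PoissonLaw

/-! ### Infinite-horizon ruin as a functional of the law of claims and counts. -/

section RuinEvent

/-- The event that the risk process built from a counting path and claims ever reaches `v`,
written in terms of countably many coordinates. -/
def ruinEvent (u c v : ℝ) : Set ((ℕ → ℝ) × (ℝ≥0 → ℕ)) :=
  {p | ∃ k, ∀ m : ℕ, ∃ n, p.2 (TopologicalSpace.denseSeq ℝ≥0 n) = k ∧
    u + c * (TopologicalSpace.denseSeq ℝ≥0 n : ℝ≥0) - ∑ i ∈ Finset.range k, p.1 i
      ≤ v + 1 / (m + 1)}

lemma measurableSet_ruinEvent (u c v : ℝ) : MeasurableSet (ruinEvent u c v) := by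
  unfold ruinEvent
  simp only [Set.ofPred_exists, Set.ofPred_forall, Set.ofPred_and]
  refine .iUnion fun k => .iInter fun m => .iUnion fun n => .inter ?_ ?_
  · exact measurableSet_eq_fun (by fun_prop) (by fun_prop)
  · exact measurableSet_le (by fun_prop) (by fun_prop)

open Classical in
/-- The infinite-horizon ruin probability `P(∃ s, R(s) ≤ v)`, computed on the canonical space of
claims and counting paths. -/
noncomputable def ultimateRuinProb (u c : ℝ) (lam : ℝ≥0) (ν : Measure ℝ) [IsProbabilityMeasure ν]
    (v : ℝ) : ℝ :=
  -- A projective limit is unique and any Poisson process supplies one, so in the presence of a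
  -- model `h.choose` is the law of `N` and the default `0` plays no role.
  if h : ∃ Q : Measure (ℝ≥0 → ℕ), IsProjectiveLimit Q (poissonMarginal lam) then
    ((Measure.infinitePi fun _ : ℕ => ν).prod h.choose).real (ruinEvent u c v)
  else 0

variable {Ω : Type*} [MeasurableSpace Ω] {P : Measure Ω} [IsProbabilityMeasure P] {lam : ℝ≥0}
  {ν : Measure ℝ} [IsProbabilityMeasure ν] {N : ℝ≥0 → Ω → ℕ} {X : ℕ → Ω → ℝ}

lemma IsClassicalModel.measure_exists_le (h : IsClassicalModel P lam ν N X) {u c : ℝ}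
    (hc : 0 ≤ c) (v : ℝ) :
    P.real {ω | ∃ s : ℝ≥0, u + c * s - ∑ i ∈ Finset.range (N s ω), X i ω ≤ v} =
      ultimateRuinProb u c lam ν v := by
  have hNm : Measurable fun ω t => N t ω := measurable_pi_iff.2 h.poisson.measurable
  have hXm : Measurable fun ω i => X i ω := measurable_pi_iff.2 h.claims.measurable
  have hex : ∃ Q : Measure (ℝ≥0 → ℕ), IsProjectiveLimit Q (poissonMarginal lam) :=
    ⟨_, h.poisson.isProjectiveLimit⟩
  have hX : P.map (fun ω i => X i ω) = Measure.infinitePi fun _ : ℕ => ν := by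
    rw [h.claims.indep.map_fun_eq_infinitePi_map h.claims.measurable]
    simp_rw [h.claims.law]
  rw [ultimateRuinProb, dif_pos hex, ← hX,
    hex.choose_spec.unique h.poisson.isProjectiveLimit,
    ← (indepFun_iff_map_prod_eq_prod_map_map hXm.aemeasurable hNm.aemeasurable).1 h.indep_claims,
    map_measureReal_apply (hXm.prodMk hNm) (measurableSet_ruinEvent u c v)]
  refine measureReal_congr ?_
  filter_upwards [h.poisson.paths] with ω hω
  exact propext (exists_le_iff_denseSeq (f := fun t => N t ω)
    (S := fun k => ∑ i ∈ Finset.range k, X i ω) hω.1 hω.2.1 hc)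

lemma tendsto_measureReal_exists_le (R : ℝ≥0 → Ω → ℝ) (v : ℝ) :
    Tendsto (fun t => P.real {ω | ∃ s ≤ t, R s ω ≤ v}) atTop (𝓝 (P.real {ω | ∃ s, R s ω ≤ v})) := by
  have hmono : Monotone fun t => {ω | ∃ s ≤ t, R s ω ≤ v} :=
    fun a b hab ω ⟨s, hs, h⟩ => ⟨s, hs.trans hab, h⟩
  have hU : ⋃ t, {ω | ∃ s ≤ t, R s ω ≤ v} = {ω | ∃ s, R s ω ≤ v} := by
    ext ω
    simp only [Set.mem_iUnion, Set.mem_ofPred_eq]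
    exact ⟨fun ⟨_, s, _, h⟩ => ⟨s, h⟩, fun ⟨s, h⟩ => ⟨s, s, le_rfl, h⟩⟩
  rw [← hU]
  exact (ENNReal.tendsto_toReal (measure_ne_top P _)).comp (tendsto_measure_iUnion_atTop hmono)

lemma IsClassicalModel.tendsto_ruinProb (h : IsClassicalModel P lam ν N X) {u mu rho : ℝ}
    (hc : 0 ≤ mu * lam * (1 + rho)) (v : ℝ) :
    Tendsto (fun t => ruinProb P (classicalRisk u mu rho lam N X) v t) atTop
      (𝓝 (ultimateRuinProb u (mu * lam * (1 + rho)) lam ν v)) := by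
  rw [← h.measure_exists_le hc]
  refine (tendsto_measureReal_exists_le (classicalRisk u mu rho lam N X) v).congr fun t => ?_
  refine measureReal_congr ?_
  filter_upwards [h.poisson.paths] with ω hω
  exact propext (sInf_image_le_iff (f := fun t => N t ω)
    (S := fun k => ∑ i ∈ Finset.range k, X i ω) hω.1 hω.2.1 hc t).symm

end RuinEvent

/-! ### Path properties of the stable clock and the time change. -/

section Fractional

variable {Ω : Type*} [MeasurableSpace Ω] {P : Measure Ω} [IsProbabilityMeasure P] {α : ℝ}
  {L : ℝ≥0 → Ω → ℝ}

/-- Chernoff bound for the lower tail. -/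
lemma IsStableSubordinator.measureReal_le (h : IsStableSubordinator P α L) (t : ℝ≥0) {s : ℝ}
    (hs : 0 ≤ s) (K : ℝ) :
    P.real {ω | L t ω ≤ K} ≤ Real.exp (s * K) * Real.exp (-(t : ℝ) * s ^ α) := by
  -- A non-integrable function would have integral `0`, but the Laplace transform is positive.
  have hint : Integrable (fun ω => Real.exp (-s * L t ω)) P :=
    not_imp_comm.1 integral_undef (by rw [h.laplace t s hs]; positivity)
  have := measure_le_le_exp_mul_mgf (μ := P) (X := L t) K (neg_nonpos.2 hs) hint
  rwa [mgf, h.laplace t s hs, neg_neg] at this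

/-- The Chernoff bound at `K = 0` vanishes as `s → ∞`. -/
lemma IsStableSubordinator.ae_pos (h : IsStableSubordinator P α L) (hα : 0 < α) {t : ℝ≥0}
    (ht : 0 < t) : ∀ᵐ ω ∂P, 0 < L t ω := by
  have hlim : Tendsto (fun s : ℝ => Real.exp (-(t : ℝ) * s ^ α)) atTop (𝓝 0) :=
    Real.tendsto_exp_atBot.comp
      ((tendsto_rpow_atTop hα).const_mul_atTop_of_neg (by simpa using ht))
  have hle : P.real {ω | L t ω ≤ 0} ≤ 0 := by
    refine ge_of_tendsto hlim ?_
    filter_upwards [eventually_ge_atTop 0] with s hs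
    simpa using h.measureReal_le t hs 0
  have h0 : P {ω | L t ω ≤ 0} = 0 :=
    (measureReal_eq_zero_iff).1 (le_antisymm hle measureReal_nonneg)
  simpa [ae_iff] using h0

/-- Stationarity makes increments between countably many dense times positive; any `s < t` has two
such times between them. -/
lemma IsStableSubordinator.ae_strictMono (h : IsStableSubordinator P α L) (hα : 0 < α) :
    ∀ᵐ ω ∂P, StrictMono fun t => L t ω := by
  let d := TopologicalSpace.denseSeq ℝ≥0
  have hd : ∀ᵐ ω ∂P, ∀ m n, d m < d n → L (d m) ω < L (d n) ω := by
    refine ae_all_iff.2 fun m => ae_all_iff.2 fun n => ?_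
    by_cases hmn : d m < d n
    · have := (h.stationary _ _ hmn.le).symm.ae_snd (p := fun x => 0 < x) measurableSet_Ioi
        (h.ae_pos hα (tsub_pos_of_lt hmn))
      filter_upwards [this] with ω hω _
      exact sub_pos.1 hω
    · simp [hmn]
  filter_upwards [hd, h.paths] with ω hω hp s t hst
  have hdense := TopologicalSpace.denseRange_denseSeq ℝ≥0
  obtain ⟨_, ⟨m, rfl⟩, hm⟩ := hdense.exists_between hst
  obtain ⟨_, ⟨n, rfl⟩, hn⟩ := hdense.exists_between hm.2
  exact (hp.1 hm.1.le).trans_lt ((hω m n hn.1).trans_le (hp.1 hn.2.le))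

lemma IsStableSubordinator.ae_unbounded (h : IsStableSubordinator P α L) :
    ∀ᵐ ω ∂P, ∀ K, ∃ w, K < L w ω := by
  have hK : ∀ K : ℕ, ∀ᵐ ω ∂P, ∃ w, (K : ℝ) < L w ω := by
    intro K
    -- This is the Chernoff bound with `s = 1` at time `n`.
    have hlim : Tendsto (fun n : ℕ => Real.exp K * Real.exp (-(n : ℝ))) atTop (𝓝 0) := by
      simpa using (Real.tendsto_exp_neg_atTop_nhds_zero.comp
        tendsto_natCast_atTop_atTop).const_mul (Real.exp K)
    have hle : P.real {ω | ∀ w, L w ω ≤ K} ≤ 0 := by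
      refine ge_of_tendsto' hlim fun n => ?_
      have := h.measureReal_le n zero_le_one K
      simp only [one_mul, Real.one_rpow, mul_one, NNReal.coe_natCast] at this
      exact (measureReal_mono fun ω (hω : ∀ w, L w ω ≤ K) => hω n).trans this
    have h0 : P {ω | ∀ w, L w ω ≤ K} = 0 :=
      (measureReal_eq_zero_iff).1 (le_antisymm hle measureReal_nonneg)
    simpa [ae_iff] using h0
  filter_upwards [ae_all_iff.2 hK] with ω hω K
  obtain ⟨n, hn⟩ := exists_nat_ge K
  obtain ⟨w, hw⟩ := hω n
  exact ⟨w, hn.trans_lt hw⟩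

variable {lam : ℝ≥0} {ν : Measure ℝ} {N : ℝ≥0 → Ω → ℕ} {X : ℕ → Ω → ℝ}

omit [IsProbabilityMeasure P] in
lemma IsFractionalModel.isClassicalModel (h : IsFractionalModel P α lam ν N L X) :
    IsClassicalModel P lam ν N X :=
  ⟨h.poisson, h.claims, h.indep_claims.comp measurable_id measurable_fst⟩

lemma IsFractionalModel.tendsto_ruinProb [IsProbabilityMeasure ν]
    (h : IsFractionalModel P α lam ν N L X) (hα : 0 < α) {u mu rho : ℝ}
    (hc : 0 ≤ mu * lam * (1 + rho)) (v : ℝ) :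
    Tendsto (fun t => ruinProb P (fractionalRisk u mu rho lam N L X) v t) atTop
      (𝓝 (ultimateRuinProb u (mu * lam * (1 + rho)) lam ν v)) := by
  rw [← h.isClassicalModel.measure_exists_le hc]
  have hlim := tendsto_measureReal_exists_le (P := P) (fractionalRisk u mu rho lam N L X) v
  have hclock : ∀ᵐ ω ∂P, L 0 ω = 0 ∧ StrictMono (fun t => L t ω) ∧ ∀ K, ∃ w, K < L w ω := by
    filter_upwards [h.stable.zero, h.stable.ae_strictMono hα, h.stable.ae_unbounded]
      with ω h1 h2 h3 using ⟨h1, h2, h3⟩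
  have hlimit : P.real {ω | ∃ s, fractionalRisk u mu rho lam N L X s ω ≤ v} =
      P.real {ω | ∃ s : ℝ≥0, u + mu * lam * (1 + rho) * s -
        ∑ i ∈ Finset.range (N s ω), X i ω ≤ v} := by
    refine measureReal_congr ?_
    filter_upwards [hclock] with ω ⟨h0, hL, _⟩
    refine propext ⟨fun ⟨s, hs⟩ => ⟨_, hs⟩, fun ⟨w, hw⟩ => ?_⟩
    obtain ⟨t, ht⟩ := exists_firstPassage_eq (L := fun t => L t ω) h0 hL w
    exact ⟨t, by rw [← ht] at hw; exact hw⟩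
  rw [hlimit] at hlim
  refine hlim.congr fun t => measureReal_congr ?_
  filter_upwards [hclock, h.poisson.paths] with ω ⟨h0, hL, hunb⟩ hω
  let F : ℝ≥0 → ℝ := fun w =>
    u + mu * lam * (1 + rho) * w - ∑ i ∈ Finset.range (N w ω), X i ω
  have himage : (fun s => inverseProcess L s ω) '' Set.Icc 0 t =
      Set.Icc 0 (inverseProcess L t ω) := image_firstPassage (L := fun t => L t ω) h0 hL hunb t
  have hinf : runningInf (fractionalRisk u mu rho lam N L X) t ω =
      sInf (F '' Set.Icc 0 (inverseProcess L t ω)) := by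
    rw [← himage, Set.image_image]
    rfl
  have hiff : (∃ s ≤ t, fractionalRisk u mu rho lam N L X s ω ≤ v) ↔
      ∃ w ≤ inverseProcess L t ω, F w ≤ v := by
    constructor
    · rintro ⟨s, hs, hle⟩
      have : inverseProcess L s ω ∈ Set.Icc 0 (inverseProcess L t ω) :=
        himage ▸ ⟨s, ⟨zero_le, hs⟩, rfl⟩
      exact ⟨_, this.2, hle⟩
    · rintro ⟨w, hw, hle⟩
      obtain ⟨s, hs, rfl⟩ : w ∈ (fun s => inverseProcess L s ω) '' Set.Icc 0 t :=
        himage ▸ ⟨zero_le, hw⟩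
      exact ⟨s, hs.2, hle⟩
  refine propext (hiff.trans (Iff.trans ?_ (Eq.to_iff (congrArg (· ≤ v) hinf.symm))))
  exact (sInf_image_le_iff (f := fun t => N t ω)
    (S := fun k => ∑ i ∈ Finset.range k, X i ω) hω.1 hω.2.1 hc _).symm

end Fractional

end FractionalRisk

theorem mainTheorem2
    (u mu rho : ℝ) (lam : ℝ≥0) (hu : 0 < u) (hmu : 0 < mu) (hrho : 0 ≤ rho) (hlam : 0 < lam)
    (ν : Measure ℝ) (hν : IsProbabilityMeasure ν) (hint : Integrable (fun x : ℝ => x) ν)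
    (hmean : ∫ x, x ∂ν = mu) :
    ∃ ψ : ℝ → ℝ,
      (∀ (Ω : Type*) [MeasurableSpace Ω] (P : Measure Ω) [IsProbabilityMeasure P]
        (N : ℝ≥0 → Ω → ℕ) (X : ℕ → Ω → ℝ),
        FractionalRisk.IsClassicalModel P lam ν N X →
        ∀ v : ℝ, Tendsto
          (fun t : ℝ≥0 => FractionalRisk.ruinProb P
            (FractionalRisk.classicalRisk u mu rho lam N X) v t) atTop (𝓝 (ψ v))) ∧
      (∀ α : ℝ, 0 < α → α < 1 →
        ∀ (Ω : Type*) [MeasurableSpace Ω] (P : Measure Ω) [IsProbabilityMeasure P]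
          (N : ℝ≥0 → Ω → ℕ) (L : ℝ≥0 → Ω → ℝ) (X : ℕ → Ω → ℝ),
          FractionalRisk.IsFractionalModel P α lam ν N L X →
          ∀ v : ℝ, Tendsto
            (fun t : ℝ≥0 => FractionalRisk.ruinProb P
              (FractionalRisk.fractionalRisk u mu rho lam N L X) v t) atTop (𝓝 (ψ v))) := by
  have hc : 0 ≤ mu * lam * (1 + rho) := by positivity
  exact ⟨FractionalRisk.ultimateRuinProb u (mu * lam * (1 + rho)) lam ν,
    fun _ _ _ _ _ _ h v => h.tendsto_ruinProb hc v,
    fun _ hα _ _ _ _ _ _ _ _ h v => h.tendsto_ruinProb hα hc v⟩
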